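/- Let $G$ be a discrete group, let $X$ be a nonempty compact Hausdorff space, and suppose that $G$ acts on $X$ by homeomorphisms in such a way that the action is minimal (every orbit is dense) and topologically free in the following sense: for every finite set $S \subset G \setminus \{1\}$, the set \[ \{ x \in X : g x \neq x \text{ for all } g \in S \} \] is dense in $X$. Let $D$ be a purely infinite simple unital C*-algebra, and let $\alpha \colon G \to \mathrm{Aut}(C(X,D))$ be an action of $G$ on $C(X,D)$ which lies over the given action of $G$ on $X$; that is, there is a function $(g,x) \mapsto \alpha_{g,x}$ from $G \times X$ to $\mathrm{Aut}(D)$ such that $\alpha_g(a)(x) = \alpha_{g,x}(a(g^{-1}x))$ for all $g \in G$, $x \in X$, and $a \in C(X,D)$. Then the reduced crossed product $C^*_{\mathrm{r}}(G, C(X,D), \alpha)$ is purely infinite and simple. Here a C*-algebra is simple if it is nonzero and has no closed two-sided ideals other than $0$ and itself, and a simple C*-algebra is purely infinite if each of its nonzero hereditary C*-subalgebras contains an infinite projection (a projection which is Murray--von Neumann equivalent to a proper subprojection of itself). The reduced crossed product is the C*-algebra of operators on $\ell^2(G,H)$ generated by the operators $(\pi_\alpha(a)\xi)(h) = \pi(\alpha_h^{-1}(a))(\xi(h))$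 for $a \in C(X,D)$ and $(\lambda_g \xi)(h) = \xi(g^{-1}h)$ for $g \in G$, where $\pi$ is any faithful unital representation of $C(X,D)$ on a Hilbert space $H$. -/

import Mathlib

open scoped ENNReal

noncomputable section

namespace CrossedPI

/-! ### Simple and purely infinite C*-algebras -/

section PurelyInfinite

variable (A : Type*) [NonUnitalCStarAlgebra A]

/-- A C*-algebra is simple if it is nonzero and its only closed two-sided ideals are `0` and the
whole algebra. -/
def IsSimple : Prop :=
  Nontrivial A ∧ ∀ I : TwoSidedIdeal A, IsClosed {a : A | a ∈ I} → I = ⊥ ∨ I = ⊤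

variable {A}

/-- `a` is a positive element of the C*-algebra `A`. -/
def IsPos (a : A) : Prop := ∃ c : A, a = star c * c

/-- `B` is a hereditary C*-subalgebra of `A`: a norm closed *-subalgebra such that
`0 ≤ a ≤ b` and `b ∈ B` imply `a ∈ B`. -/
def IsHereditary (B : NonUnitalStarSubalgebra ℂ A) : Prop :=
  IsClosed (B : Set A) ∧ ∀ a b : A, IsPos a → IsPos (b - a) → b ∈ B → a ∈ B

/-- Murray-von Neumann equivalence of projections. -/
def MvNEquiv (p q : A) : Prop := ∃ v : A, star v * v = p ∧ v * star v = q

/-- A projection is infinite if it is Murray-von Neumann equivalent to a proper subprojection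
of itself. -/
def IsInfiniteProjection (p : A) : Prop :=
  IsStarProjection p ∧ ∃ q : A, IsStarProjection q ∧ p * q = q ∧ q ≠ p ∧ MvNEquiv p q

variable (A)

/-- A C*-algebra is purely infinite and simple if it is simple and every nonzero hereditary
C*-subalgebra contains an infinite projection. -/
def IsPurelyInfiniteSimple : Prop :=
  IsSimple A ∧ ∀ B : NonUnitalStarSubalgebra ℂ A, IsHereditary B → (∃ b ∈ B, b ≠ 0) →
    ∃ p ∈ B, IsInfiniteProjection p

end PurelyInfinite

/-! ### The reduced crossed product of a unital C*-algebra by a discrete group -/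

section CrossedProduct

variable {G : Type*} [Group G]
variable {A : Type*} [CStarAlgebra A]
variable {H : Type*} [NormedAddCommGroup H]

/-- The Hilbert space `ℓ²(G, H)`. -/
abbrev ell2 (G H : Type*) [NormedAddCommGroup H] : Type _ := lp (fun _ : G => H) 2

theorem memlp_translate (g : G) (ξ : ell2 G H) :
    Memℓp (fun h : G => ξ (g⁻¹ * h)) (2 : ℝ≥0∞) :=
  memℓp_gen (((lp.memℓp ξ).summable (by norm_num)).comp_injective (mul_right_injective g⁻¹))

variable [InnerProductSpace ℂ H]

/-- The left translation operator on `ℓ²(G, H)`, given by `(λ_g ξ)(h) = ξ(g⁻¹ h)`. -/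
def translation (H : Type*) [NormedAddCommGroup H] [InnerProductSpace ℂ H] (g : G) :
    ell2 G H →L[ℂ] ell2 G H :=
  LinearMap.mkContinuous
    { toFun := fun ξ => ⟨fun h => ξ (g⁻¹ * h), memlp_translate g ξ⟩
      map_add' := fun _ _ => rfl
      map_smul' := fun _ _ => rfl } 1 (fun ξ => by
    rw [one_mul]
    refine lp.norm_le_of_tsum_le (p := 2) (by norm_num) (norm_nonneg _) ?_
    rw [lp.norm_rpow_eq_tsum (by norm_num) ξ]
    exact ((Equiv.mulLeft g⁻¹).tsum_eq (fun h => ‖ξ h‖ ^ (2 : ℝ≥0∞).toReal)).le)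

theorem translation_apply (g : G) (ξ : ell2 G H) (h : G) :
    translation H g ξ h = ξ (g⁻¹ * h) := rfl

variable [CompleteSpace H]

/-- The operator on `ℓ²(G, H)` given by `(π_α(a) ξ)(h) = π(α_h⁻¹(a)) (ξ(h))`. -/
def regularRep (α : G →* (A ≃⋆ₐ[ℂ] A)) (π : A →⋆ₐ[ℂ] (H →L[ℂ] H)) (a : A) :
    ell2 G H →L[ℂ] ell2 G H :=
  lp.mapCLM 2 (fun h : G => π (α h⁻¹ a)) (K := ‖a‖) (norm_nonneg a) (fun h =>
    (NonUnitalStarAlgHom.norm_apply_le π _).trans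
      (NonUnitalStarAlgHom.norm_apply_le (α h⁻¹ : A ≃⋆ₐ[ℂ] A) a))

theorem regularRep_apply (α : G →* (A ≃⋆ₐ[ℂ] A)) (π : A →⋆ₐ[ℂ] (H →L[ℂ] H)) (a : A)
    (ξ : ell2 G H) (h : G) : regularRep α π a ξ h = π (α h⁻¹ a) (ξ h) := rfl

/-- The reduced crossed product `C*_r(G, A, α)` of a unital C*-algebra `A` by an action `α` of a
discrete group `G`, realized through a faithful unital representation `π` of `A` on a Hilbert space
`H`: the C*-algebra of operators on `ℓ²(G, H)` generated by the operators `π_α(a)`, `a ∈ A`, and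
`λ_g`, `g ∈ G`. -/
def reducedCrossedProduct (α : G →* (A ≃⋆ₐ[ℂ] A)) (π : A →⋆ₐ[ℂ] (H →L[ℂ] H)) :
    StarSubalgebra ℂ (ell2 G H →L[ℂ] ell2 G H) :=
  (StarAlgebra.adjoin ℂ
    (Set.range (regularRep α π) ∪ Set.range (translation H : G → _))).topologicalClosure

instance isClosed_reducedCrossedProduct (α : G →* (A ≃⋆ₐ[ℂ] A)) (π : A →⋆ₐ[ℂ] (H →L[ℂ] H)) :
    IsClosed (reducedCrossedProduct α π : Set (ell2 G H →L[ℂ] ell2 G H)) :=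
  StarSubalgebra.isClosed_topologicalClosure _

end CrossedProduct

/-! ### Group actions on `X` and on `C(X, D)` -/

section Actions

/-- For every finite `S ⊆ G \ {1}`, the set of points moved by all elements of `S` is dense. -/
def IsTopologicallyFree (G X : Type*) [Group G] [TopologicalSpace X] [MulAction G X] : Prop :=
  ∀ S : Finset G, (1 : G) ∉ S → Dense {x : X | ∀ g ∈ S, g • x ≠ x}

/-- The action `α` of `G` on `C(X, D)` lies over the action of `G` on `X`: there are automorphisms
`α_{g,x}` of `D` with `α_g(a)(x) = α_{g,x}(a(g⁻¹ x))`. -/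
def LiesOver {G X D : Type*} [Group G] [TopologicalSpace X] [CompactSpace X] [MulAction G X]
    [CStarAlgebra D] (α : G →* (C(X, D) ≃⋆ₐ[ℂ] C(X, D))) : Prop :=
  ∃ β : G → X → (D ≃⋆ₐ[ℂ] D), ∀ (g : G) (x : X) (a : C(X, D)), α g a x = β g x (a (g⁻¹ • x))

end Actions

end CrossedPI

end

/-! By `isPurelyInfiniteSimple_of_isUnit` it is enough to have one non-unitary isometry, which
constant functions supply from `D`, and to find for each nonzero `c` some `t` with `(ct)*(ct)`
invertible. Invertibility gives simplicity at once. It also gives an isometry `v` in `cB`, and `vv*`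
is then an infinite projection in any hereditary subalgebra containing `c`.

To find `t`, replace `c` by a translate `c λ_g` so that the diagonal coefficient of `b = (c λ_g)*(c
λ_g)` is nonzero (`exists_corner_ne_zero`). Approximate `b` by some `b' = T*T` in the algebraic
crossed product, with positive coefficient `a` at the unit. Only finitely many other group elements
occur in `b'`, and topological freeness gives a point `x₀` that all of them move and at which `a` is
still large. For a bump function `f` near `x₀`, a cut-down by functions supported where `f` is
leaves only `a` (`exists_cutDown`). Pure infiniteness of `D` gives `d` with `d* a(x₀) d = 1` and
norm control (`exists_star_mul_mul_eq_one`). With `F = f ⊗ d` this makes `F* b F` close to the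
scalar function `f²`, hence at least `f² - 1/4`.

A further scalar cut-down leaves a nonzero nonnegative function `q` as a lower bound. By minimality
finitely many translates of `q` add up to at least some `δ > 0`. Isometries of `D` with orthogonal
ranges realize this sum as a single conjugate `z* q z` (`exists_conjugate_scalarFun_ge`), so `b` is
compressed to an invertible element. -/

namespace CrossedPI

/-! ### Unital C*-algebras: isometries, simplicity and a criterion for pure infiniteness -/

section CStar

attribute [local instance] CStarAlgebra.spectralOrder CStarAlgebra.spectralOrderedRing

variable {B : Type*} [CStarAlgebra B]

theorem isPos_iff_nonneg {a : B} : IsPos a ↔ 0 ≤ a :=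
  CStarAlgebra.nonneg_iff_eq_star_mul_self.symm

/-- An element whose absolute square is invertible can be corrected to an isometry. -/
theorem exists_isometry_of_isUnit {y : B} (hy : IsUnit (star y * y)) :
    ∃ k : B, star (y * k) * (y * k) = 1 := by
  have hp : IsStrictlyPositive (star y * y) := hy.isStrictlyPositive (star_mul_self_nonneg y)
  have h0 : IsSelfAdjoint ((star y * y) ^ (-(1 / 2) : ℝ)) := .of_nonneg CFC.rpow_nonneg
  refine ⟨(star y * y) ^ (-(1 / 2) : ℝ), ?_⟩
  rw [star_mul, h0.star_eq, mul_assoc, ← mul_assoc (star y), ← mul_assoc]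
  exact CFC.conjugate_rpow_neg_one_half _ hp

/-- From `1 = y*(x*x)y ≤ ‖x‖² y*y`, the element `y*y` is bounded below by a positive scalar. -/
theorem isUnit_star_mul_self_of_mul_eq_one {x y : B} (h : x * y = 1) : IsUnit (star y * y) := by
  nontriviality B
  have h1 : (1 : B) ≤ ‖x‖ ^ 2 • (star y * y) := by
    have := star_left_conjugate_le_conjugate (CStarAlgebra.star_mul_le_algebraMap_norm_sq (a := x)) y
    calc (1 : B) = star y * (star x * x) * y := by
          rw [mul_assoc, mul_assoc, h, mul_one, ← star_mul, h, star_one]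
      _ ≤ _ := this
      _ = _ := by rw [Algebra.algebraMap_eq_smul_one, mul_smul_comm, smul_mul_assoc, mul_one]
  have h2 := CStarAlgebra.isUnit_of_le (1 : B) h1
  have h3 : ‖x‖ ^ 2 ≠ 0 := by
    rintro h0
    have : x = 0 := by simpa using h0
    simp [this] at h
  exact (isUnit_smul_iff (Units.mk0 _ h3) _).1 h2

theorem exists_isometry_of_mul_eq_one {x y : B} (h : x * y = 1) :
    ∃ k : B, star (y * k) * (y * k) = 1 :=
  exists_isometry_of_isUnit (isUnit_star_mul_self_of_mul_eq_one h)

open scoped Pointwise in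
/-- In a simple unital C*-algebra every nonzero element generates the algebra algebraically as a
two-sided ideal. -/
theorem exists_sum_mul_mul_eq_one (hB : IsSimple B) {r : B} (hr : r ≠ 0) :
    ∃ (n : ℕ) (x y : Fin n → B), ∑ i, x i * r * y i = 1 := by
  obtain ⟨hnt, hI⟩ := hB
  let I : TwoSidedIdeal B := TwoSidedIdeal.span {r}
  let J : TwoSidedIdeal B := TwoSidedIdeal.mk' (closure (I : Set B))
    (subset_closure I.zero_mem)
    (fun {x y} hx hy => map_mem_closure₂ continuous_add hx hy fun a ha b hb => I.add_mem ha hb)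
    (fun {x} hx => map_mem_closure continuous_neg hx fun a ha => I.neg_mem ha)
    (fun {x y} hy => map_mem_closure (continuous_const_mul x) hy fun a ha =>
      I.mul_mem_left _ _ ha)
    (fun {x y} hx => map_mem_closure (f := fun z => z * y) (continuous_mul_const y) hx
      fun a ha => I.mul_mem_right _ _ ha)
  have hJ : ∀ a, a ∈ J ↔ a ∈ closure (I : Set B) := fun a => by
    simp only [J, TwoSidedIdeal.mem_mk']
  have hrI : r ∈ I := TwoSidedIdeal.subset_span rfl
  have h1J : (1 : B) ∈ closure (I : Set B) := by
    rcases hI J (by simp only [hJ]; exact isClosed_closure) with h | h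
    · have : r ∈ J := (hJ r).2 (subset_closure hrI)
      rw [h] at this
      exact absurd ((TwoSidedIdeal.mem_bot _).1 this) hr
    · rw [← hJ, h]; trivial
  -- An element at distance less than `1` from the unit is invertible, so the algebraic ideal, not
  -- just its closure, contains `1`.
  obtain ⟨a, haI, ha⟩ := Metric.mem_closure_iff.1 h1J 1 one_pos
  rw [dist_eq_norm] at ha
  have hu : IsUnit a := by
    have := (Units.oneSub (1 - a) ha).isUnit
    simpa using this
  obtain ⟨u, rfl⟩ := hu
  have h1 : (1 : B) ∈ I := by
    rw [← u.inv_mul]; exact I.mul_mem_left _ _ haI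
  rw [TwoSidedIdeal.mem_span_iff_mem_addSubgroup_closure] at h1
  have key : ∀ a ∈ AddSubgroup.closure (Set.univ * ({r} : Set B) * Set.univ : Set B),
      ∃ (n : ℕ) (x y : Fin n → B), ∑ i, x i * r * y i = a := by
    intro a ha
    induction ha using AddSubgroup.closure_induction with
    | mem a ha =>
      obtain ⟨_, ⟨x, -, _, rfl, rfl⟩, y, -, rfl⟩ := ha
      exact ⟨1, fun _ => x, fun _ => y, by simp⟩
    | zero => exact ⟨0, fun _ => 0, fun _ => 0, by simp⟩
    | add a b _ _ ha hb =>
      obtain ⟨n, x, y, rfl⟩ := ha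
      obtain ⟨m, x', y', rfl⟩ := hb
      exact ⟨n + m, Fin.append x x', Fin.append y y', by simp [Fin.sum_univ_add]⟩
    | neg a _ ha =>
      obtain ⟨n, x, y, rfl⟩ := ha
      exact ⟨n, fun i => -x i, y, by simp⟩
  exact key 1 h1

theorem star_pow_mul_pow {w : B} (hw : star w * w = 1) (i : ℕ) : star w ^ i * w ^ i = 1 := by
  induction i with
  | zero => simp
  | succ i ih => rw [pow_succ, pow_succ', mul_assoc, ← mul_assoc (star w) w, hw, one_mul, ih]

/-- Cancelling the smaller power leaves a positive power of `w` or `w*` next to `r`, and `rw = 0`,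
`w*r = 0`. Thus the shifts `w ^ j * r` of the defect projection have orthogonal ranges. -/
theorem star_pow_mul_pow_orthogonal {w r : B} (hw : star w * w = 1) (hr : star r = r)
    (hrw : r * w = 0) {i j : ℕ} (hij : i ≠ j) : r * star w ^ i * (w ^ j * r) = 0 := by
  have hwr : star w * r = 0 := by simpa [hr] using congrArg star hrw
  rcases lt_or_gt_of_ne hij with h | h
  · obtain ⟨k, rfl⟩ := Nat.exists_eq_add_of_lt h
    rw [show i + k + 1 = i + (k + 1) by ring, pow_add w, mul_assoc r, mul_assoc (w ^ i),
      ← mul_assoc (star w ^ i), star_pow_mul_pow hw, one_mul, pow_succ', ← mul_assoc,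
      ← mul_assoc, hrw]
    simp
  · obtain ⟨k, rfl⟩ := Nat.exists_eq_add_of_lt h
    rw [show j + k + 1 = (k + 1) + j by ring, pow_add (star w), mul_assoc r, mul_assoc (star w ^ _),
      ← mul_assoc (star w ^ j), star_pow_mul_pow hw, one_mul, pow_succ, mul_assoc _ (star w), hwr]
    simp

/-- If a projection `p` commutes with an isometry `w` and dominates its defect projection, then
`p` dominates the range projection of an isometry. -/
theorem exists_isometry_range_le (hB : IsSimple B) {w p : B} (hw : star w * w = 1)
    (hw' : w * star w ≠ 1) (hpw : p * w = w * p) (hp : p * (1 - w * star w) = 1 - w * star w) :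
    ∃ v : B, star v * v = 1 ∧ p * v = v := by
  set r := 1 - w * star w with hrdef
  have hr0 : r ≠ 0 := fun h => hw' (sub_eq_zero.1 h).symm
  have hrs : star r = r := by simp [r]
  have hrw : r * w = 0 := by rw [hrdef, sub_mul, mul_assoc, hw]; simp
  have hrr : r * r = r := by
    nth_rw 2 [hrdef]; rw [mul_sub, ← mul_assoc, hrw]; simp
  obtain ⟨n, x, y, hxy⟩ := exists_sum_mul_mul_eq_one hB hr0
  -- Orthogonality of the shifts `w ^ j * r` turns the sum of `n` terms given by simplicity into one
  -- product. The right factor normalizes to an isometry, and `p` fixes it because `p` commutes with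
  -- `w` and fixes `r`.
  have hXY : (∑ i : Fin n, x i * (r * star w ^ (i : ℕ))) * (∑ j : Fin n, w ^ (j : ℕ) * r * y j)
      = 1 := by
    rw [Finset.sum_mul_sum, ← hxy]
    refine Finset.sum_congr rfl fun i _ => ?_
    rw [Finset.sum_eq_single i]
    · rw [mul_assoc (x i), ← mul_assoc _ _ (y i), ← mul_assoc (r * _), mul_assoc r,
        star_pow_mul_pow hw, mul_one, hrr, ← mul_assoc]
    · intro j _ hji
      rw [mul_assoc (x i), ← mul_assoc _ _ (y j),
        star_pow_mul_pow_orthogonal hw hrs hrw (fun h => hji (Fin.ext h.symm))]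
      simp
    · simp
  obtain ⟨k, hk⟩ := exists_isometry_of_mul_eq_one hXY
  refine ⟨_, hk, ?_⟩
  rw [← mul_assoc, Finset.mul_sum]
  congr 1
  refine Finset.sum_congr rfl fun i _ => ?_
  have : Commute p (w ^ (i : ℕ)) := Commute.pow_right hpw _
  rw [← mul_assoc, ← mul_assoc, this.eq, mul_assoc _ p, hp]

/-- An infinite projection gives a non-unitary isometry commuting with it and with defect
below it. -/
theorem IsInfiniteProjection.exists_isometry {p : B} (h : IsInfiniteProjection p) :
    ∃ w : B, star w * w = 1 ∧ w * star w ≠ 1 ∧ p * w = w * p ∧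
      p * (1 - w * star w) = 1 - w * star w := by
  obtain ⟨hp, q, hq, hpq, hne, v, hv1, hv2⟩ := h
  have hpp : p * p = p := hp.isIdempotentElem
  have hps : star p = p := hp.isSelfAdjoint
  have hqs : star q = q := hq.isSelfAdjoint
  have hqq : q * q = q := hq.isIdempotentElem
  have hvp : v * p = v := by
    have : star (v * p - v) * (v * p - v) = 0 := by
      have : star (v * p - v) * (v * p - v)
        = p * (star v * v) * p - p * (star v * v) - (star v * v) * p + star v * v := by
        rw [star_sub, star_mul, hps]; noncomm_ring
      rw [this, hv1, hpp, hpp]; simp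
    exact sub_eq_zero.1 ((CStarRing.star_mul_self_eq_zero_iff _).1 this)
  have hpv : p * v = v := by
    have : (p * v - v) * star (p * v - v) = 0 := by
      have : (p * v - v) * star (p * v - v)
        = p * (v * star v) * p - p * (v * star v) - (v * star v) * p + v * star v := by
        rw [star_sub, star_mul, hps]; noncomm_ring
      have hqp : q * p = q := by simpa [hps, hqs] using congrArg star hpq
      rw [this, hv2, hpq, hqp]; simp
    exact sub_eq_zero.1 ((CStarRing.mul_star_self_eq_zero_iff _).1 this)
  have hpsv : p * star v = star v := by simpa [hps] using congrArg star hvp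
  have hsvp : star v * p = star v := by simpa [hps] using congrArg star hpv
  -- The isometry is `v` on `p` extended by the identity on `1 - p`. Its defect is `p - q`, which is
  -- nonzero and lies below `p`.
  have hww : (v + (1 - p)) * star (v + (1 - p)) = q + (1 - p) := by
    have : (v + (1 - p)) * star (v + (1 - p)) = v * star v + (v - v * p) + (star v - p * star v)
        + (1 - p - p + p * p) := by
      rw [star_add, star_sub, star_one, hps]; noncomm_ring
    rw [this, hv2, hvp, hpsv, hpp]; noncomm_ring
  refine ⟨v + (1 - p), ?_, ?_, ?_, ?_⟩
  · have : star (v + (1 - p)) * (v + (1 - p)) = star v * v + (star v - star v * p) + (v - p * v)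
        + (1 - p - p + p * p) := by
      rw [star_add, star_sub, star_one, hps]; noncomm_ring
    rw [this, hv1, hsvp, hpv, hpp]; noncomm_ring
  · rw [hww]
    intro h
    exact hne (by
      have := congrArg (fun z => z - 1 + p) h
      simp only [sub_self, zero_add] at this
      rw [← this]; abel)
  · rw [mul_add, add_mul, hpv, hvp, mul_sub, sub_mul]; simp
  · rw [hww]
    have : p * (1 - (q + (1 - p))) = p * p - p * q := by noncomm_ring
    rw [this, hpp, hpq]; noncomm_ring

/-- A criterion for pure infiniteness and simplicity of a unital C*-algebra. -/
theorem isPurelyInfiniteSimple_of_isUnit {w : B} (hw : star w * w = 1) (hw' : w * star w ≠ 1)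
    (h : ∀ c : B, c ≠ 0 → ∃ t : B, IsUnit (star (c * t) * (c * t))) :
    IsPurelyInfiniteSimple B := by
  have hnt : Nontrivial B := ⟨_, _, hw'⟩
  refine ⟨⟨hnt, fun I _ => ?_⟩, ?_⟩
  · by_cases hI : ∃ c ∈ I, c ≠ 0
    · obtain ⟨c, hcI, hc⟩ := hI
      obtain ⟨t, u, hu⟩ := h c hc
      right
      have h1 : (1 : B) ∈ I := by
        rw [← u.inv_mul, hu]
        exact I.mul_mem_left _ _ (I.mul_mem_left _ _ (I.mul_mem_right _ _ hcI))
      exact (TwoSidedIdeal.one_mem_iff I).1 h1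
    · left
      push Not at hI
      exact le_bot_iff.1 fun x hx => (TwoSidedIdeal.mem_bot _).2 (hI x hx)
  · rintro S ⟨-, hS⟩ ⟨c, hcS, hc⟩
    obtain ⟨t, ht⟩ := h c hc
    obtain ⟨k, hk⟩ := exists_isometry_of_isUnit ht
    obtain ⟨v, hv⟩ : ∃ v, v = c * t * k := ⟨_, rfl⟩
    rw [← hv] at hk
    -- Hereditariness applies through `vv* = c(tk)(tk)*c* ≤ ‖tk‖² cc*`.
    have hmem : v * star v ∈ S := by
      refine hS _ (‖t * k‖ ^ 2 • (c * star c)) ⟨star v, by simp⟩ (isPos_iff_nonneg.2 ?_) ?_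
      · have := star_right_conjugate_le_conjugate
          (CStarAlgebra.mul_star_le_algebraMap_norm_sq (a := t * k)) c
        rw [sub_nonneg]
        calc v * star v = c * (t * k * star (t * k)) * star c := by
              rw [hv, mul_assoc c, star_mul]; noncomm_ring
          _ ≤ _ := this
          _ = _ := by rw [Algebra.algebraMap_eq_smul_one, mul_smul_comm, smul_mul_assoc, mul_one]
      · have := S.smul_mem (r := ((‖t * k‖ ^ 2 : ℝ) : ℂ)) (S.mul_mem hcS (S.star_mem' hcS))
        rwa [Complex.coe_smul] at this
    have hvv : v * star v * (v * star v) = v * star v := by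
      rw [mul_assoc, ← mul_assoc (star v), hk, one_mul]
    -- Conjugation by `v` carries the proper equivalence `1 ~ ww*` to `vv* ~ vww*v*`, implemented by
    -- `vwv*`.
    refine ⟨v * star v, hmem, ⟨hvv, by simp [IsSelfAdjoint]⟩, v * w * star (v * w),
      ⟨?_, by simp [IsSelfAdjoint]⟩, ?_, ?_, v * w * star v, ?_, ?_⟩
    · calc v * w * star (v * w) * (v * w * star (v * w))
          = v * w * (star w * (star v * v) * w) * star (v * w) := by
            rw [star_mul]; noncomm_ring
        _ = _ := by rw [hk, mul_one, hw, mul_one]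
    · calc v * star v * (v * w * star (v * w)) = v * (star v * v) * w * star (v * w) := by
            simp only [mul_assoc]
        _ = _ := by rw [hk, mul_one]
    · intro heq
      apply hw'
      calc w * star w = (star v * v) * (w * star w) * (star v * v) := by rw [hk]; simp
        _ = star v * (v * w * star (v * w)) * v := by rw [star_mul]; noncomm_ring
        _ = (star v * v) * (star v * v) := by rw [heq]; noncomm_ring
        _ = 1 := by rw [hk, one_mul]
    · calc star (v * w * star v) * (v * w * star v)
          = v * (star w * (star v * v) * w) * star v := by
            rw [star_mul, star_mul, star_star]; noncomm_ring
        _ = _ := by rw [hk, mul_one, hw, mul_one]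
    · calc (v * w * star v) * star (v * w * star v)
          = v * w * (star v * v) * star (v * w) := by
            rw [star_mul, star_star]; noncomm_ring
        _ = _ := by rw [hk, mul_one]

end CStar

/-! ### Compression to the unit in a purely infinite simple unital C*-algebra -/

section PurelyInfiniteUnital

attribute [local instance] CStarAlgebra.spectralOrder CStarAlgebra.spectralOrderedRing

variable {D : Type*} [CStarAlgebra D]

/-- The hereditary C*-subalgebra of elements annihilated on both sides by `m`. -/
def annihilatorSubalgebra (m : D) (hm : star m = m) : NonUnitalStarSubalgebra ℂ D where
  carrier := {a | a * m = 0 ∧ m * a = 0}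
  zero_mem' := by simp
  add_mem' := fun ha hb => ⟨by rw [add_mul, ha.1, hb.1, add_zero],
    by rw [mul_add, ha.2, hb.2, add_zero]⟩
  mul_mem' := fun ha hb => ⟨by rw [mul_assoc, hb.1, mul_zero],
    by rw [← mul_assoc, ha.2, zero_mul]⟩
  smul_mem' := fun c a ha => ⟨by rw [smul_mul_assoc, ha.1, smul_zero],
    by rw [mul_smul_comm, ha.2, smul_zero]⟩
  star_mem' := fun {a} ha => ⟨by simpa [hm] using congrArg star ha.2,
    by simpa [hm] using congrArg star ha.1⟩

theorem isHereditary_annihilatorSubalgebra (m : D) (hm : star m = m) :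
    IsHereditary (annihilatorSubalgebra m hm) := by
  constructor
  · exact (isClosed_eq (continuous_mul_const m) continuous_const).inter
      (isClosed_eq (continuous_const_mul m) continuous_const)
  · rintro a b ⟨x, rfl⟩ hab hb
    rw [isPos_iff_nonneg, sub_nonneg] at hab
    have h1 : star (x * m) * (x * m) = 0 := by
      apply le_antisymm _ (star_mul_self_nonneg _)
      calc star (x * m) * (x * m) = star m * (star x * x) * m := by
            rw [star_mul]; simp only [mul_assoc]
        _ ≤ star m * b * m := star_left_conjugate_le_conjugate hab m
        _ = 0 := by rw [mul_assoc, hb.1, mul_zero]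
    have h2 : x * m = 0 := (CStarRing.star_mul_self_eq_zero_iff _).1 h1
    have h3 : m * star x = 0 := by simpa [hm] using congrArg star h2
    exact ⟨by rw [mul_assoc, h2, mul_zero], by rw [← mul_assoc, h3, zero_mul]⟩

/-- In a purely infinite simple unital C*-algebra, a nonzero positive element can be compressed
to the unit, with control on the norm. -/
theorem IsPurelyInfiniteSimple.exists_star_mul_mul_eq_one (hD : IsPurelyInfiniteSimple D) {c : D}
    (hc : IsPos c) (hc0 : c ≠ 0) :
    ∃ d : D, star d * c * d = 1 ∧ ‖d‖ ^ 2 ≤ 2 / ‖c‖ := by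
  have hnt : Nontrivial D := hD.1.1
  rw [isPos_iff_nonneg] at hc
  have hsa : IsSelfAdjoint c := .of_nonneg hc
  have hκ : 0 < ‖c‖ := norm_pos_iff.2 hc0
  set κ := ‖c‖ with hκdef
  -- `ψ` is `1/t` truncated at `t = κ/2`, so it is continuous and bounded by `2/κ`. That bound
  -- becomes the bound on `‖d‖²`.
  obtain ⟨ψ, hψ, hψ0, hψ1, hψ2⟩ : ∃ ψ : ℝ → ℝ, Continuous ψ ∧ (∀ t : ℝ, 0 ≤ ψ t) ∧
      (∀ t : ℝ, ψ t ≤ 2 / κ) ∧ ∀ t : ℝ, κ / 2 ≤ t → t * ψ t = 1 := by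
    have hpos : ∀ t : ℝ, 0 < max t (κ / 2) := fun t => lt_max_of_lt_right (by positivity)
    refine ⟨fun t => (max t (κ / 2))⁻¹,
      (by fun_prop : Continuous fun t : ℝ => max t (κ / 2)).inv₀ fun t => (hpos t).ne',
      fun t => inv_nonneg.2 (hpos t).le, fun t => ?_, fun t ht => ?_⟩
    · change (max t (κ / 2))⁻¹ ≤ 2 / κ
      rw [← inv_div κ 2]
      exact inv_anti₀ (half_pos hκ) (le_max_right _ _)
    · have : 0 < t := by linarith
      simp only
      rw [max_eq_left ht, mul_inv_cancel₀ this.ne']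
  have hψs : Continuous fun t => Real.sqrt (ψ t) := hψ.sqrt
  have hψm : Continuous fun t => t * ψ t := continuous_id.mul hψ
  have hψm' : Continuous fun t => 1 - t * ψ t := continuous_const.sub hψm
  have hφ : Continuous fun t : ℝ => max (t - κ / 2) 0 := by fun_prop
  -- Here `scs = 1 - m`, where `m` is the error of the truncation and vanishes on the spectral part
  -- `t ≥ κ/2`. The element `e` lives on that part and is nonzero because `‖c‖` lies in the
  -- spectrum. An isometry `v` with range under a projection annihilated by `m` then satisfies
  -- `v*(scs)v = 1`.
  let s : D := cfc (fun t => Real.sqrt (ψ t)) c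
  let m : D := cfc (fun t => 1 - t * ψ t) c
  let e : D := cfc (fun t => max (t - κ / 2) 0) c
  have hms : star m = m := (cfc_predicate _ c : IsSelfAdjoint m).star_eq
  have hss : star s = s := (cfc_predicate _ c : IsSelfAdjoint s).star_eq
  have hscs : s * c * s = 1 - m := by
    have h1 : s * c * s = cfc (fun t => Real.sqrt (ψ t) * t * Real.sqrt (ψ t)) c := by
      rw [cfc_mul (fun t => Real.sqrt (ψ t) * t) _ c (hψs.mul continuous_id).continuousOn
        hψs.continuousOn, cfc_mul _ (fun t => t) c hψs.continuousOn continuous_id.continuousOn,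
        cfc_id' ℝ c]
    have h2 : (1 : D) - m = cfc (fun t => 1 - (1 - t * ψ t)) c := by
      rw [cfc_sub _ _ c continuousOn_const hψm'.continuousOn, cfc_const_one ℝ c]
    rw [h1, h2]
    refine cfc_congr fun t _ => ?_
    have : Real.sqrt (ψ t) * Real.sqrt (ψ t) = ψ t :=
      Real.mul_self_sqrt (hψ0 t)
    linear_combination t * this
  have hme : m * e = 0 := by
    have : m * e = cfc (fun t => (1 - t * ψ t) * max (t - κ / 2) 0) c :=
      (cfc_mul _ _ c hψm'.continuousOn hφ.continuousOn).symm
    rw [this, ← cfc_const_zero ℝ c]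
    refine cfc_congr fun t _ => ?_
    rcases le_total t (κ / 2) with h | h
    · rw [max_eq_right (by linarith), mul_zero]
    · rw [hψ2 t h, sub_self, zero_mul]
  have hes : star e = e := (cfc_predicate _ c : IsSelfAdjoint e).star_eq
  have hem : e * m = 0 := by simpa [hes, hms] using congrArg star hme
  have he0 : e ≠ 0 := by
    intro h
    have h1 := norm_apply_le_norm_cfc (fun t => max (t - κ / 2) 0) c
      (CStarAlgebra.norm_mem_spectrum_of_nonneg hc) hφ.continuousOn
    rw [show cfc (fun t => max (t - κ / 2) 0) c = 0 from h, norm_zero, ← hκdef,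
      max_eq_left (by linarith), Real.norm_eq_abs, abs_of_pos (by linarith)] at h1
    linarith
  obtain ⟨p, hp, hinf⟩ := hD.2 (annihilatorSubalgebra m hms)
    (isHereditary_annihilatorSubalgebra m hms) ⟨e, ⟨hem, hme⟩, he0⟩
  obtain ⟨w, hw1, hw2, hw3, hw4⟩ := hinf.exists_isometry
  obtain ⟨v, hv1, hv2⟩ := exists_isometry_range_le hD.1 hw1 hw2 hw3 hw4
  have hmv : m * v = 0 := by rw [← hv2, ← mul_assoc, hp.2, zero_mul]
  refine ⟨s * v, ?_, ?_⟩
  · calc star (s * v) * c * (s * v) = star v * (s * c * s) * v := by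
          rw [star_mul, hss]; simp only [mul_assoc]
      _ = 1 := by rw [hscs, mul_assoc, sub_mul, hmv, one_mul, sub_zero, hv1]
  · have hv : ‖v‖ = 1 := by
      have := CStarRing.norm_star_mul_self (x := v)
      rw [hv1, norm_one] at this
      nlinarith [norm_nonneg v]
    have hs : ‖s‖ ≤ Real.sqrt (2 / κ) := by
      refine norm_cfc_le (Real.sqrt_nonneg _) fun t _ => ?_
      rw [Real.norm_eq_abs, abs_of_nonneg (Real.sqrt_nonneg _)]
      exact Real.sqrt_le_sqrt (hψ1 t)
    have hsv : ‖s * v‖ ≤ Real.sqrt (2 / κ) := by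
      calc ‖s * v‖ ≤ ‖s‖ * ‖v‖ := norm_mul_le _ _
        _ ≤ _ := by rw [hv, mul_one]; exact hs
    calc ‖s * v‖ ^ 2 ≤ Real.sqrt (2 / κ) ^ 2 := by gcongr
      _ = _ := Real.sq_sqrt (by positivity)

/-- A purely infinite simple unital C*-algebra contains a non-unitary isometry. -/
theorem IsPurelyInfiniteSimple.exists_isometry (hD : IsPurelyInfiniteSimple D) :
    ∃ w : D, star w * w = 1 ∧ w * star w ≠ 1 := by
  have hnt : Nontrivial D := hD.1.1
  obtain ⟨p, -, hinf⟩ := hD.2 ⊤ ⟨by simp, fun _ _ _ _ _ => trivial⟩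
    ⟨1, trivial, one_ne_zero⟩
  obtain ⟨w, hw1, hw2, -⟩ := hinf.exists_isometry
  exact ⟨w, hw1, hw2⟩

/-- A purely infinite simple unital C*-algebra contains a sequence of isometries with orthogonal
ranges. -/
theorem IsPurelyInfiniteSimple.exists_orthogonal_isometries (hD : IsPurelyInfiniteSimple D) :
    ∃ s : ℕ → D, ∀ i j, star (s i) * s j = if i = j then 1 else 0 := by
  obtain ⟨w, hw1, hw2⟩ := hD.exists_isometry
  set r := 1 - w * star w with hrdef
  have hr0 : r ≠ 0 := fun h => hw2 (sub_eq_zero.1 h).symm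
  have hrs : star r = r := by simp [r]
  have hrw : r * w = 0 := by rw [hrdef, sub_mul, mul_assoc, hw1]; simp
  have hrr : r * r = r := by
    nth_rw 2 [hrdef]; rw [mul_sub, ← mul_assoc, hrw]; simp
  obtain ⟨d, hd, -⟩ := hD.exists_star_mul_mul_eq_one ⟨r, by rw [hrs, hrr]⟩ hr0
  refine ⟨fun i => w ^ i * r * d, fun i j => ?_⟩
  have h1 : star (w ^ i * r * d) * (w ^ j * r * d)
      = star d * (r * star w ^ i * (w ^ j * r)) * d := by
    rw [star_mul, star_mul, hrs, star_pow]; simp only [mul_assoc]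
  rw [h1]
  split_ifs with h
  · subst h
    rw [mul_assoc r, ← mul_assoc (star w ^ i), star_pow_mul_pow hw1, one_mul, hrr, hd]
  · rw [star_pow_mul_pow_orthogonal hw1 hrs hrw h, mul_zero, zero_mul]

end PurelyInfiniteUnital

/-! ### Positivity under injective homomorphisms -/

section Positivity

attribute [local instance] CStarAlgebra.spectralOrder CStarAlgebra.spectralOrderedRing

/-- An injective unital *-homomorphism of C*-algebras reflects positivity. -/
theorem isPos_of_map_isPos {A B : Type*} [CStarAlgebra A] [CStarAlgebra B] (φ : A →⋆ₐ[ℂ] B)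
    (hφ : Function.Injective φ) {a : A} (ha : IsPos (φ a)) : IsPos a := by
  rw [isPos_iff_nonneg] at ha ⊢
  have hsa : IsSelfAdjoint a := hφ (by rw [map_star, (IsSelfAdjoint.of_nonneg ha).star_eq])
  have hcont : Continuous φ := (NonUnitalStarAlgHom.isometry φ hφ).continuous
  -- The functional calculus commutes with `φ`, so the negative part of `a` is sent to that of `φ
  -- a`, which is zero.
  have h1 : φ (cfcₙ (fun x : ℝ => x⁻) a) = cfcₙ (fun x : ℝ => x⁻) (φ a) :=
    NonUnitalStarAlgHomClass.map_cfcₙ (S := ℂ) φ (fun x : ℝ => x⁻) a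
      (by simp only [negPart_def]; fun_prop) (by simp) hcont hsa (IsSelfAdjoint.of_nonneg ha)
  rw [← CFC.negPart_def, ← CFC.negPart_def, (CFC.negPart_eq_zero_iff (φ a)
    (IsSelfAdjoint.of_nonneg ha)).2 ha] at h1
  exact (CFC.negPart_eq_zero_iff a hsa).1 (hφ (by rw [h1, map_zero]))

end Positivity

/-! ### Operators on `ℓ²(G, H)`: diagonal compression and the algebraic crossed product -/

section Regular

variable {G : Type*} [Group G] {A : Type*} [CStarAlgebra A]
variable {H : Type*} [NormedAddCommGroup H] [InnerProductSpace ℂ H]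

theorem translation_mul (g h : G) :
    translation H g * translation H h = translation H (g * h) := by
  ext ξ k
  simp [translation_apply, mul_assoc]

theorem translation_one : translation H (1 : G) = 1 := by
  ext ξ k
  simp [translation_apply]

theorem translation_single [DecidableEq G] (g h : G) (a : H) :
    translation H g (lp.single 2 h a) = lp.single 2 (g * h) a := by
  ext k
  rw [translation_apply, lp.single_apply, lp.single_apply]
  simp only [Pi.single_apply, inv_mul_eq_iff_eq_mul]

open Classical in
/-- The compression of an operator on `ℓ²(G, H)` to the coordinate of the unit of `G`. -/
noncomputable def corner (T : ell2 G H →L[ℂ] ell2 G H) : H →L[ℂ] H :=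
  lp.evalCLM ℂ (fun _ : G => H) 2 1 ∘L T ∘L lp.singleContinuousLinearMap ℂ (fun _ : G => H) 2 1

theorem corner_apply [DecidableEq G] (T : ell2 G H →L[ℂ] ell2 G H) (a : H) :
    corner T a = T (lp.single 2 1 a) 1 := by
  obtain rfl : ‹DecidableEq G› = Classical.decEq G := Subsingleton.elim _ _
  rfl

theorem norm_corner_le (T : ell2 G H →L[ℂ] ell2 G H) : ‖corner T‖ ≤ ‖T‖ := by
  classical
  refine ContinuousLinearMap.opNorm_le_bound _ T.opNorm_nonneg fun a => ?_
  rw [corner_apply]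
  calc _ ≤ ‖T (lp.single 2 1 a)‖ := lp.norm_apply_le_norm (by norm_num) _ _
    _ ≤ ‖T‖ * ‖(lp.single 2 1 a : ell2 G H)‖ := T.le_opNorm _
    _ = _ := by rw [lp.norm_single (by norm_num)]

theorem corner_sub (S T : ell2 G H →L[ℂ] ell2 G H) : corner (S - T) = corner S - corner T := by
  classical
  ext a; simp [corner_apply]

theorem corner_add (S T : ell2 G H →L[ℂ] ell2 G H) : corner (S + T) = corner S + corner T := by
  classical
  ext a; simp [corner_apply]

theorem corner_smul (c : ℂ) (T : ell2 G H →L[ℂ] ell2 G H) : corner (c • T) = c • corner T := by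
  classical
  ext a; simp [corner_apply]

variable [CompleteSpace H]

theorem star_translation (g : G) : star (translation H g) = translation H g⁻¹ := by
  rw [ContinuousLinearMap.star_eq_adjoint, eq_comm, ContinuousLinearMap.eq_adjoint_iff]
  intro x y
  rw [lp.inner_eq_tsum, lp.inner_eq_tsum, ← (Equiv.mulLeft g⁻¹).tsum_eq]
  exact tsum_congr fun h => by simp [translation_apply]

variable (α : G →* (A ≃⋆ₐ[ℂ] A)) (π : A →⋆ₐ[ℂ] (H →L[ℂ] H))

/-- The regular representation of the coefficient algebra as a *-homomorphism. -/
noncomputable def regularHom : A →⋆ₐ[ℂ] (ell2 G H →L[ℂ] ell2 G H) where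
  toFun := regularRep α π
  map_one' := by ext ξ h; simp [regularRep_apply]
  map_mul' a b := by ext ξ h; simp [regularRep_apply]
  map_zero' := by ext ξ h; simp [regularRep_apply]
  map_add' a b := by ext ξ h; simp [regularRep_apply]
  commutes' r := by ext ξ h; simp [regularRep_apply, Algebra.algebraMap_eq_smul_one]
  map_star' a := by
    rw [ContinuousLinearMap.star_eq_adjoint, ContinuousLinearMap.eq_adjoint_iff]
    intro x y
    rw [lp.inner_eq_tsum, lp.inner_eq_tsum]
    refine tsum_congr fun h => ?_
    rw [regularRep_apply, regularRep_apply, map_star, map_star,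
      ContinuousLinearMap.star_eq_adjoint, ContinuousLinearMap.adjoint_inner_left]

theorem regularHom_apply (a : A) : regularHom α π a = regularRep α π a := rfl

theorem translation_mul_regularHom (g : G) (a : A) :
    translation H g * regularHom α π a = regularHom α π (α g a) * translation H g := by
  ext ξ h
  simp [regularHom_apply, translation_apply, regularRep_apply]

/-- Evaluation at the unit coordinate is adjoint to inclusion of that coordinate. The factorization
yields positivity of the compression and shows that its vanishing kills the column of `T` at the
unit. -/
theorem corner_star_mul_self [DecidableEq G] (T : ell2 G H →L[ℂ] ell2 G H) :
    corner (star T * T) =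
      ContinuousLinearMap.adjoint (T ∘L lp.singleContinuousLinearMap ℂ (fun _ : G => H) 2 1) ∘L
        (T ∘L lp.singleContinuousLinearMap ℂ (fun _ : G => H) 2 1) := by
  ext a
  refine ext_inner_right ℂ fun b => ?_
  rw [corner_apply, ContinuousLinearMap.comp_apply, ContinuousLinearMap.adjoint_inner_left,
    ContinuousLinearMap.comp_apply, ContinuousLinearMap.comp_apply,
    lp.singleContinuousLinearMap_apply, lp.singleContinuousLinearMap_apply,
    mul_apply_eq_comp, ← ContinuousLinearMap.adjoint_inner_left,
    lp.inner_single_right, ContinuousLinearMap.star_eq_adjoint]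

theorem isPos_corner_star_mul_self (T : ell2 G H →L[ℂ] ell2 G H) :
    IsPos (corner (star T * T)) := by
  classical
  rw [corner_star_mul_self]
  exact CStarAlgebra.nonneg_iff_eq_star_mul_self.1 (ContinuousLinearMap.nonneg_iff_isPositive _ |>.2
    (ContinuousLinearMap.isPositive_adjoint_comp_self _))

/-- The coefficients of a nonzero operator cannot all vanish on the diagonal of its square. -/
theorem exists_corner_ne_zero {T : ell2 G H →L[ℂ] ell2 G H} (hT : T ≠ 0) :
    ∃ g : G, corner (star (T * translation H g) * (T * translation H g)) ≠ 0 := by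
  classical
  by_contra! h
  apply hT
  -- The column of `T` at `g` is the column of `T λ_g` at the unit.
  have key : ∀ (g : G) (a : H), T (lp.single 2 g a) = 0 := by
    intro g a
    have h1 := h g
    rw [corner_star_mul_self] at h1
    have h2 : (T * translation H g) ∘L lp.singleContinuousLinearMap ℂ (fun _ : G => H) 2 1 = 0 := by
      have := ContinuousLinearMap.norm_adjoint_comp_self
        ((T * translation H g) ∘L lp.singleContinuousLinearMap ℂ (fun _ : G => H) 2 1)
      rw [h1, norm_zero] at this
      exact norm_eq_zero.1 (mul_self_eq_zero.1 this.symm)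
    have h3 := congrArg (fun S => S a) h2
    simpa [translation_single] using h3
  ext1 ξ
  have h1 := (lp.hasSum_single (by norm_num) ξ).mapL T
  simp only [key] at h1
  simpa using h1.unique hasSum_zero

/-- The span of the products `π_α(a) λ_g`. -/
noncomputable def coeffSpan : Submodule ℂ (ell2 G H →L[ℂ] ell2 G H) :=
  Submodule.span ℂ (Set.range fun q : A × G => regularHom α π q.1 * translation H q.2)

theorem regularHom_mul_translation_mem (a : A) (g : G) :
    regularHom α π a * translation H g ∈ coeffSpan α π :=
  Submodule.subset_span ⟨(a, g), rfl⟩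

/-- Covariance moves `λ_g` to the right past a coefficient `b`, at the price of replacing `b` by
`α_g(b)`. -/
theorem mul_mem_coeffSpan {S T : ell2 G H →L[ℂ] ell2 G H} (hS : S ∈ coeffSpan α π)
    (hT : T ∈ coeffSpan α π) : S * T ∈ coeffSpan α π := by
  have h := Submodule.mul_mem_mul hS hT
  rw [coeffSpan, Submodule.span_mul_span] at h
  refine Submodule.span_le.2 ?_ h
  rintro _ ⟨_, ⟨⟨a, g⟩, rfl⟩, _, ⟨⟨b, k⟩, rfl⟩, rfl⟩
  have : regularHom α π a * translation H g * (regularHom α π b * translation H k)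
      = regularHom α π (a * α g b) * translation H (g * k) := by
    rw [mul_assoc, ← mul_assoc (translation H g), translation_mul_regularHom, mul_assoc,
      translation_mul, map_mul, mul_assoc]
  simp only [this]
  exact regularHom_mul_translation_mem α π _ _

theorem star_mem_coeffSpan {T : ell2 G H →L[ℂ] ell2 G H}
    (hT : T ∈ coeffSpan α π) : star T ∈ coeffSpan α π := by
  induction hT using Submodule.span_induction with
  | mem T hT =>
    obtain ⟨⟨a, g⟩, rfl⟩ := hT
    rw [star_mul, star_translation, ← map_star, translation_mul_regularHom]
    exact regularHom_mul_translation_mem α π _ _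
  | zero => rw [star_zero]; exact Submodule.zero_mem _
  | add S T _ _ hS hT => rw [star_add]; exact Submodule.add_mem _ hS hT
  | smul c T _ hT => rw [star_smul]; exact Submodule.smul_mem _ _ hT

theorem mem_coeffSpan_of_mem_adjoin {T : ell2 G H →L[ℂ] ell2 G H}
    (hT : T ∈ StarAlgebra.adjoin ℂ
      (Set.range (regularRep α π) ∪ Set.range (translation H : G → _))) :
    T ∈ coeffSpan α π := by
  have hreg : ∀ a, regularHom α π a ∈ coeffSpan α π := fun a => by
    simpa [translation_one] using regularHom_mul_translation_mem α π a 1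
  induction hT using StarAlgebra.adjoin_induction with
  | mem T hT =>
    rcases hT with ⟨a, rfl⟩ | ⟨g, rfl⟩
    · exact hreg a
    · simpa using regularHom_mul_translation_mem α π 1 g
  | algebraMap r =>
    rw [← AlgHomClass.commutes (regularHom α π)]
    exact hreg _
  | add S T _ _ hS hT => exact Submodule.add_mem _ hS hT
  | mul S T _ _ hS hT => exact mul_mem_coeffSpan α π hS hT
  | star T _ hT => exact star_mem_coeffSpan α π hT

end Regular

/-! ### Isolating the coefficient at the unit -/

section CutDown

variable {G X D : Type*} [Group G] [TopologicalSpace X] [CompactSpace X] [MulAction G X]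
variable [CStarAlgebra D] {α : G →* (C(X, D) ≃⋆ₐ[ℂ] C(X, D))}
variable {H : Type*} [NormedAddCommGroup H] [InnerProductSpace ℂ H] [CompleteSpace H]

/-- The supports of `f` and of `k` translated by each element of `S` are disjoint. -/
def IsSeparated (S : Finset G) (f k : C(X, D)) : Prop :=
  ∀ g ∈ S, ∀ x : X, f x = 0 ∨ k (g⁻¹ • x) = 0

/-- Cutting an element of the algebraic crossed product down by functions with separated supports
only leaves its coefficient at the unit. -/
theorem exists_cutDown (hα : LiesOver α) (π : C(X, D) →⋆ₐ[ℂ] (H →L[ℂ] H))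
    {T : ell2 G H →L[ℂ] ell2 G H} (hT : T ∈ coeffSpan α π) :
    ∃ (a : C(X, D)) (S : Finset G), (1 : G) ∉ S ∧ corner T = π a ∧
      ∀ f k : C(X, D), IsSeparated S f k →
        regularHom α π f * T * regularHom α π k = regularHom α π (f * a * k) := by
  classical
  obtain ⟨β, hβ⟩ := hα
  induction hT using Submodule.span_induction with
  | mem T hT =>
    obtain ⟨⟨a, g⟩, rfl⟩ := hT
    by_cases hg : g = 1
    · subst hg
      refine ⟨a, ∅, by simp, ?_, fun f k _ => ?_⟩
      · ext v
        simp [corner_apply, translation_one, regularHom_apply, regularRep_apply]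
      · simp only [translation_one, mul_one, map_mul]
    · refine ⟨0, {g}, by simpa using Ne.symm hg, ?_, fun f k hfk => ?_⟩
      · ext v
        rw [corner_apply, mul_apply_eq_comp, translation_single]
        simp [regularHom_apply, regularRep_apply, lp.single_apply, Ne.symm hg]
      · have h0 : f * a * α g k = 0 := by
          ext x
          rcases hfk g (by simp) x with h | h
          · simp [h]
          · simp [hβ, h]
        simp only
        rw [mul_assoc, mul_assoc, translation_mul_regularHom, ← mul_assoc, ← mul_assoc, ← map_mul,
          ← map_mul, h0]
        simp
  | zero => exact ⟨0, ∅, by simp, by ext v; simp [corner_apply], by simp⟩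
  | add T U _ _ hT hU =>
    obtain ⟨a, S, hS, ha, haS⟩ := hT
    obtain ⟨b, S', hS', hb, hbS⟩ := hU
    refine ⟨a + b, S ∪ S', by simp [hS, hS'], by rw [corner_add, ha, hb, map_add],
      fun f k hfk => ?_⟩
    rw [mul_add, add_mul, haS f k fun g hg => hfk g (Finset.mem_union_left _ hg),
      hbS f k fun g hg => hfk g (Finset.mem_union_right _ hg), mul_add, add_mul, map_add]
  | smul c T _ hT =>
    obtain ⟨a, S, hS, ha, haS⟩ := hT
    refine ⟨c • a, S, hS, by rw [corner_smul, ha, map_smul], fun f k hfk => ?_⟩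
    rw [mul_smul_comm, smul_mul_assoc, haS f k hfk, mul_smul_comm, smul_mul_assoc, map_smul]

end CutDown

/-! ### Scalar functions, bump functions and minimality -/

section ScalarFunctions

variable {X D : Type*} [TopologicalSpace X] [CStarAlgebra D]

/-- A real function on `X` as a scalar element of `C(X, D)`. -/
noncomputable def scalarFun (D : Type*) [CStarAlgebra D] (k : C(X, ℝ)) : C(X, D) :=
  ⟨fun x => k x • (1 : D), by fun_prop⟩

@[simp]
theorem scalarFun_apply (k : C(X, ℝ)) (x : X) : scalarFun D k x = k x • (1 : D) := rfl

theorem star_scalarFun (k : C(X, ℝ)) : star (scalarFun D k) = scalarFun D k := by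
  ext x; simp

theorem scalarFun_mul (k l : C(X, ℝ)) : scalarFun D (k * l) = scalarFun D k * scalarFun D l := by
  ext x; simp [smul_smul, mul_comm]

theorem scalarFun_sub (k l : C(X, ℝ)) : scalarFun D (k - l) = scalarFun D k - scalarFun D l := by
  ext x; simp [sub_smul]

theorem scalarFun_sum {ι : Type*} (s : Finset ι) (k : ι → C(X, ℝ)) :
    scalarFun D (∑ i ∈ s, k i) = ∑ i ∈ s, scalarFun D (k i) := by
  ext x; simp [ContinuousMap.sum_apply, Finset.sum_smul]

theorem scalarFun_const (r : ℝ) :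
    scalarFun D (ContinuousMap.const X r) = algebraMap ℝ C(X, D) r := by
  ext x; simp [Algebra.algebraMap_eq_smul_one]

/-- A point moved by all elements of a finite set has a neighbourhood disjoint from its
translates. -/
theorem exists_isOpen_disjoint_translates {G : Type*} [Group G] [MulAction G X]
    [ContinuousConstSMul G X] [T2Space X] (S : Finset G) {x₀ : X} (h : ∀ g ∈ S, g • x₀ ≠ x₀)
    {W : Set X} (hW : W ∈ nhds x₀) :
    ∃ V ⊆ W, IsOpen V ∧ x₀ ∈ V ∧ ∀ g ∈ S, ∀ x ∈ V, g⁻¹ • x ∉ V := by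
  have key : ∀ g ∈ S, ∃ V ∈ nhds x₀, ∀ x ∈ V, g⁻¹ • x ∉ V := by
    intro g hg
    have hne : x₀ ≠ g⁻¹ • x₀ := fun h0 => h g hg (by rw [← inv_smul_eq_iff.1 h0.symm])
    obtain ⟨U₁, U₂, hU₁, hU₂, h1, h2, hdisj⟩ := t2_separation hne
    refine ⟨U₁ ∩ (fun x => g⁻¹ • x) ⁻¹' U₂, Filter.inter_mem (hU₁.mem_nhds h1)
      ((hU₂.preimage (continuous_const_smul _)).mem_nhds h2), fun x hx hx' => ?_⟩
    exact Set.disjoint_left.1 hdisj hx'.1 hx.2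
  choose! V hV hV' using key
  have hmem : W ∩ ⋂ g ∈ S, V g ∈ nhds x₀ :=
    Filter.inter_mem hW ((Filter.biInter_finset_mem S).2 hV)
  obtain ⟨U, hU, hUo, hxU⟩ := mem_nhds_iff.1 hmem
  refine ⟨U, fun x hx => (hU hx).1, hUo, hxU, fun g hg x hx hx' => ?_⟩
  exact hV' g hg x (Set.mem_iInter₂.1 (hU hx).2 g hg) (Set.mem_iInter₂.1 (hU hx').2 g hg)

variable [CompactSpace X]

/-- The unit compressed by a function `f ⊗ d` approximates `f²` where `d` compresses `a` to the
unit approximately. -/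
theorem norm_compress_sub_le {a : C(X, D)} {f : C(X, ℝ)} {d : D} {x₀ : X} {ε : ℝ} (hε : 0 ≤ ε)
    (hf : ∀ x, f x ∈ Set.Icc (0 : ℝ) 1) (hd : star d * a x₀ * d = 1)
    (ha : ∀ x, f x ≠ 0 → ‖a x - a x₀‖ ≤ ε) :
    ‖star (scalarFun D f * ContinuousMap.const X d) * a * (scalarFun D f * ContinuousMap.const X d)
      - scalarFun D (f * f)‖ ≤ ‖d‖ ^ 2 * ε := by
  rw [ContinuousMap.norm_le _ (by positivity)]
  intro x
  have h1 : (star (scalarFun D f * ContinuousMap.const X d) * a *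
      (scalarFun D f * ContinuousMap.const X d) - scalarFun D (f * f)) x
      = (f x * f x) • (star d * (a x - a x₀) * d) := by
    rw [mul_sub, sub_mul, hd]
    simp [smul_smul, smul_sub]
  rw [h1]
  by_cases hx : f x = 0
  · simp [hx]; positivity
  · calc ‖(f x * f x) • (star d * (a x - a x₀) * d)‖
        = (f x * f x) * ‖star d * (a x - a x₀) * d‖ := by
          rw [norm_smul, Real.norm_eq_abs, abs_of_nonneg (mul_self_nonneg _)]
      _ ≤ 1 * ‖star d * (a x - a x₀) * d‖ := by
          gcongr
          nlinarith [(hf x).1, (hf x).2]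
      _ ≤ ‖star d‖ * ‖a x - a x₀‖ * ‖d‖ := by
          rw [one_mul]; exact norm_mul₃_le
      _ ≤ ‖d‖ * ε * ‖d‖ := by rw [norm_star]; gcongr; exact ha x hx
      _ = ‖d‖ ^ 2 * ε := by ring

theorem norm_scalarFun_mul_const_le {f : C(X, ℝ)} (d : D) (hf : ∀ x, f x ∈ Set.Icc (0 : ℝ) 1) :
    ‖scalarFun D f * ContinuousMap.const X d‖ ≤ ‖d‖ := by
  rw [ContinuousMap.norm_le _ (norm_nonneg _)]
  intro x
  simp only [ContinuousMap.mul_apply, scalarFun_apply, ContinuousMap.const_apply, smul_mul_assoc,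
    one_mul, norm_smul, Real.norm_eq_abs, abs_of_nonneg (hf x).1]
  exact mul_le_of_le_one_left (norm_nonneg _) (hf x).2

/-- The fibre automorphisms fix scalar multiples of `1`, so on scalar functions only the action on
`X` remains. -/
theorem LiesOver.apply_scalarFun {G : Type*} [Group G] [MulAction G X] [ContinuousConstSMul G X]
    {α : G →* (C(X, D) ≃⋆ₐ[ℂ] C(X, D))} (hα : LiesOver α) (g : G) (k : C(X, ℝ)) :
    α g (scalarFun D k) = scalarFun D (k.comp ⟨fun x => g⁻¹ • x, continuous_const_smul _⟩) := by
  obtain ⟨β, hβ⟩ := hα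
  ext x
  rw [hβ, scalarFun_apply, scalarFun_apply, ← Complex.coe_smul, map_smul, map_one,
    Complex.coe_smul]
  rfl

/-- In a minimal system finitely many translates of a nonzero nonnegative function have a sum
bounded away from zero. -/
theorem exists_sum_translates_ge {G : Type*} [Group G] [MulAction G X] [ContinuousConstSMul G X]
    [MulAction.IsMinimal G X] [Nonempty X] {q : C(X, ℝ)} (hq : ∀ x, 0 ≤ q x) {x₀ : X}
    (hx₀ : 0 < q x₀) :
    ∃ (I : Finset G) (δ : ℝ), 0 < δ ∧ ∀ x, δ ≤ ∑ g ∈ I, q (g⁻¹ • x) := by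
  -- By minimality and compactness, finitely many translates of `{q > 0}` cover `X`. The constant
  -- `δ` is the minimum of the continuous sum of translates.
  obtain ⟨I, hI⟩ := (isCompact_univ (X := X)).exists_finite_cover_smul G
    (U := {x | 0 < q x}) (isOpen_lt continuous_const q.continuous) ⟨x₀, hx₀⟩
  have hcont : Continuous fun x => ∑ g ∈ I, q (g⁻¹ • x) :=
    continuous_finsetSum _ fun g _ => q.continuous.comp (continuous_const_smul _)
  obtain ⟨y, -, hy⟩ := (isCompact_univ (X := X)).exists_isMinOn Set.univ_nonempty
    hcont.continuousOn
  refine ⟨I, _, ?_, fun x => hy (Set.mem_univ x)⟩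
  obtain ⟨g, hg, hgy⟩ := Set.mem_iUnion₂.1 (hI (Set.mem_univ y))
  exact Finset.sum_pos' (fun g _ => hq _) ⟨g, hg, Set.mem_smul_set_iff_inv_smul_mem.1 hgy⟩

end ScalarFunctions

/-! ### Compression to an invertible element in a covariant representation -/

section Covariant

attribute [local instance] CStarAlgebra.spectralOrder CStarAlgebra.spectralOrderedRing

variable {G X D B : Type*} [Group G] [TopologicalSpace X] [MulAction G X]
variable [CStarAlgebra D] [CStarAlgebra B]

/-- The pointwise square root exhibits the image as an absolute square. -/
theorem map_scalarFun_nonneg (ρ : C(X, D) →⋆ₐ[ℂ] B) {k : C(X, ℝ)} (hk : ∀ x, 0 ≤ k x) :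
    0 ≤ ρ (scalarFun D k) := by
  let l : C(X, ℝ) := ⟨fun x => Real.sqrt (k x), by fun_prop⟩
  have h : k = l * l := by ext x; exact (Real.mul_self_sqrt (hk x)).symm
  rw [h, scalarFun_mul, map_mul]
  nth_rw 1 [← star_scalarFun]
  rw [map_star]
  exact star_mul_self_nonneg _

theorem map_scalarFun_mono (ρ : C(X, D) →⋆ₐ[ℂ] B) {k l : C(X, ℝ)} (hk : ∀ x, k x ≤ l x) :
    ρ (scalarFun D k) ≤ ρ (scalarFun D l) := by
  rw [← sub_nonneg, ← map_sub, ← scalarFun_sub]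
  exact map_scalarFun_nonneg ρ fun x => sub_nonneg.2 (hk x)

variable [CompactSpace X] {α : G →* (C(X, D) ≃⋆ₐ[ℂ] C(X, D))}

theorem map_scalarFun_const (ρ : C(X, D) →⋆ₐ[ℂ] B) (r : ℝ) :
    ρ (scalarFun D (ContinuousMap.const X r)) = algebraMap ℝ B r := by
  rw [scalarFun_const, Algebra.algebraMap_eq_smul_one, Algebra.algebraMap_eq_smul_one,
    ← Complex.coe_smul, map_smul, map_one, Complex.coe_smul]

/-- In a covariant representation of a minimal system with purely infinite simple fibre, a nonzero
nonnegative scalar function is full, by means of a single element. -/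
theorem exists_conjugate_scalarFun_ge [ContinuousConstSMul G X] [MulAction.IsMinimal G X]
    [Nonempty X] (hD : IsPurelyInfiniteSimple D) (hα : LiesOver α) (ρ : C(X, D) →⋆ₐ[ℂ] B)
    (u : G → B) (hu : ∀ g a, u g * ρ a = ρ (α g a) * u g) (hu1 : ∀ g, u g * u g⁻¹ = 1)
    (hus : ∀ g, star (u g) = u g⁻¹) {q : C(X, ℝ)} (hq : ∀ x, 0 ≤ q x) {x₀ : X}
    (hx₀ : 0 < q x₀) :
    ∃ (z : B) (δ : ℝ), 0 < δ ∧ algebraMap ℝ B δ ≤ star z * ρ (scalarFun D q) * z := by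
  classical
  obtain ⟨I, δ, hδ, hI⟩ := exists_sum_translates_ge (G := G) hq hx₀
  obtain ⟨s, hs⟩ := hD.exists_orthogonal_isometries
  -- The injection `e` assigns distinct isometries to the elements of `I`. Their orthogonal ranges
  -- remove the cross terms of `z* q z`, and the diagonal terms are the translates of `q`.
  obtain ⟨e, he⟩ := Set.countable_iff_exists_injOn.1 I.countable_toSet
  refine ⟨∑ g ∈ I, ρ (ContinuousMap.const X (s (e g))) * u g⁻¹, δ, hδ, ?_⟩
  have hterm : ∀ g ∈ I, ∀ k ∈ I, star (ρ (ContinuousMap.const X (s (e g))) * u g⁻¹) *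
      ρ (scalarFun D q) * (ρ (ContinuousMap.const X (s (e k))) * u k⁻¹) =
      if g = k then
        ρ (scalarFun D (q.comp ⟨fun x => g⁻¹ • x, continuous_const_smul _⟩)) else 0 := by
    intro g hg k hk
    have h1 : star (ContinuousMap.const X (s (e g))) * scalarFun D q *
        ContinuousMap.const X (s (e k)) = if g = k then scalarFun D q else 0 := by
      ext x
      have h2 := hs (e g) (e k)
      simp only [he.eq_iff hg hk] at h2
      split_ifs at h2 ⊢ with h
      · simp [h2]
      · simp [h2]
    have h3 : star (ρ (ContinuousMap.const X (s (e g))) * u g⁻¹) * ρ (scalarFun D q) *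
        (ρ (ContinuousMap.const X (s (e k))) * u k⁻¹) =
        u g * ρ (star (ContinuousMap.const X (s (e g))) * scalarFun D q *
        ContinuousMap.const X (s (e k))) * u k⁻¹ := by
      rw [star_mul, hus, inv_inv, map_mul, map_mul, map_star]
      simp only [mul_assoc]
    rw [h3, h1]
    split_ifs with h
    · subst h
      rw [hu, mul_assoc, hu1, mul_one, hα.apply_scalarFun]
    · simp
  have hsum : star (∑ g ∈ I, ρ (ContinuousMap.const X (s (e g))) * u g⁻¹) * ρ (scalarFun D q) *
      (∑ g ∈ I, ρ (ContinuousMap.const X (s (e g))) * u g⁻¹) = ρ (scalarFun D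
        (∑ g ∈ I, q.comp ⟨fun x => g⁻¹ • x, continuous_const_smul _⟩)) := by
    rw [star_sum, Finset.sum_mul, Finset.sum_mul_sum, scalarFun_sum, map_sum]
    refine Finset.sum_congr rfl fun g hg => ?_
    rw [Finset.sum_congr rfl (hterm g hg), Finset.sum_ite_eq, if_pos hg]
  rw [hsum, ← map_scalarFun_const (D := D) (X := X) ρ]
  refine map_scalarFun_mono ρ fun x => ?_
  simpa [ContinuousMap.sum_apply] using hI x

/-- An element that is approximated by elements which cut down to large positive elements of
`C(X, D)` can be compressed to an invertible element. -/
theorem exists_isUnit_conjugate [ContinuousConstSMul G X] [MulAction.IsMinimal G X] [T2Space X]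
    [Nonempty X] (hfree : IsTopologicallyFree G X) (hD : IsPurelyInfiniteSimple D)
    (hα : LiesOver α) (ρ : C(X, D) →⋆ₐ[ℂ] B)
    (u : G → B) (hu : ∀ g a, u g * ρ a = ρ (α g a) * u g) (hu1 : ∀ g, u g * u g⁻¹ = 1)
    (hus : ∀ g, star (u g) = u g⁻¹) {b : B} (hb : IsSelfAdjoint b) {κ : ℝ} (hκ : 0 < κ)
    (happ : ∀ ε > 0, ∃ (b' : B) (a : C(X, D)) (S : Finset G), ‖b - b'‖ ≤ ε ∧ IsPos a ∧
      κ ≤ ‖a‖ ∧ (1 : G) ∉ S ∧ ∀ f k : C(X, D), IsSeparated S f k →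
        ρ f * b' * ρ k = ρ (f * a * k)) :
    ∃ t : B, IsUnit (star t * b * t) := by
  -- The tolerance has to be fixed before `x₀` and `d` are known. The bound `‖d‖² ≤ 2/‖a x₀‖ ≤ 4/κ`
  -- depends only on `κ`, so `κ/32` guarantees an error of at most `1/8`. Such an error occurs
  -- twice: for `b` against `b'`, and for `a` against `a x₀`.
  obtain ⟨b', a, S, hbb', ha, haκ, hS, hcut⟩ := happ (κ / 32) (by positivity)
  obtain ⟨x₁, hx₁⟩ : ∃ x, κ / 2 < ‖a x‖ := by
    by_contra! h
    have := (ContinuousMap.norm_le a (by positivity)).2 h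
    linarith
  obtain ⟨x₀, hx₀κ, hx₀S⟩ := (hfree S hS).inter_open_nonempty {x | κ / 2 < ‖a x‖}
    (isOpen_lt continuous_const (by fun_prop)) ⟨x₁, hx₁⟩
  have hpos : IsPos (a x₀) := by
    obtain ⟨m, rfl⟩ := ha
    exact ⟨m x₀, rfl⟩
  have hx₀κ : κ / 2 < ‖a x₀‖ := hx₀κ
  have hne : a x₀ ≠ 0 := by
    intro h
    rw [h, norm_zero] at hx₀κ
    linarith
  obtain ⟨d, hd, hdn⟩ := hD.exists_star_mul_mul_eq_one hpos hne
  have hdn' : ‖d‖ ^ 2 * (κ / 32) ≤ 1 / 8 := by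
    have : 2 / ‖a x₀‖ ≤ 4 / κ := by
      rw [div_le_div_iff₀ (by linarith) hκ]; linarith
    calc ‖d‖ ^ 2 * (κ / 32) ≤ 4 / κ * (κ / 32) := by gcongr; exact hdn.trans this
      _ = 1 / 8 := by field_simp; norm_num
  obtain ⟨V, hVW, hVo, hxV, hVS⟩ := exists_isOpen_disjoint_translates S hx₀S
    (W := {x | ‖a x - a x₀‖ < κ / 32})
    ((isOpen_lt (by fun_prop) continuous_const).mem_nhds (by simpa using by positivity))
  obtain ⟨f, hf0, hf1, hf⟩ := exists_continuous_zero_one_of_isClosed hVo.isClosed_compl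
    (isClosed_singleton (x := x₀)) (by simpa using hxV)
  have hfV : ∀ x, f x ≠ 0 → x ∈ V := fun x hx => by
    by_contra h
    exact hx (hf0 h)
  set F : C(X, D) := scalarFun D f * ContinuousMap.const X d with hF
  have hF0 : ∀ x, f x = 0 → F x = 0 := fun x hx => by simp [hF, hx]
  have hsep : IsSeparated S (star F) F := by
    intro g hg x
    by_cases hx : f x = 0
    · left; simp [hF0 x hx]
    · right
      apply hF0
      by_contra h
      exact hVS g hg x (hfV x hx) (hfV _ h)
  have h1 : ‖star F * a * F - scalarFun D (f * f)‖ ≤ 1 / 8 :=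
    (norm_compress_sub_le (by positivity) hf hd fun x hx => (hVW (hfV x hx)).le).trans hdn'
  have hρF : ‖ρ F‖ ≤ ‖d‖ :=
    (NonUnitalStarAlgHom.norm_apply_le ρ F).trans (norm_scalarFun_mul_const_le d hf)
  have h2 : ‖star (ρ F) * b * ρ F - ρ (star F * a * F)‖ ≤ 1 / 8 := by
    rw [← hcut _ _ hsep, map_star, ← sub_mul, ← mul_sub]
    calc ‖star (ρ F) * (b - b') * ρ F‖ ≤ ‖star (ρ F)‖ * ‖b - b'‖ * ‖ρ F‖ := norm_mul₃_le
      _ ≤ ‖d‖ * (κ / 32) * ‖d‖ := by rw [norm_star]; gcongr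
      _ = ‖d‖ ^ 2 * (κ / 32) := by ring
      _ ≤ _ := hdn'
  have h3 : ‖star (ρ F) * b * ρ F - ρ (scalarFun D (f * f))‖ ≤ 1 / 4 := by
    have h4 : ‖ρ (star F * a * F) - ρ (scalarFun D (f * f))‖ ≤ 1 / 8 := by
      rw [← map_sub]
      exact (NonUnitalStarAlgHom.norm_apply_le ρ _).trans h1
    calc _ ≤ _ := norm_sub_le_norm_sub_add_norm_sub _ (ρ (star F * a * F)) _
      _ ≤ 1 / 8 + 1 / 8 := add_le_add h2 h4
      _ = 1 / 4 := by norm_num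
  have hsa : IsSelfAdjoint (star (ρ F) * b * ρ F - ρ (scalarFun D (f * f))) :=
    (hb.conjugate' _).sub (IsSelfAdjoint.map (star_scalarFun _) ρ)
  have h5 : ρ (scalarFun D (f * f - ContinuousMap.const X (1 / 4))) ≤ star (ρ F) * b * ρ F := by
    rw [scalarFun_sub, map_sub, map_scalarFun_const, sub_le_iff_le_add, ← sub_le_iff_le_add',
      ← neg_le_neg_iff, neg_sub]
    calc -algebraMap ℝ B (1 / 4)
        ≤ -algebraMap ℝ B ‖star (ρ F) * b * ρ F - ρ (scalarFun D (f * f))‖ := by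
          rw [neg_le_neg_iff]; exact algebraMap_mono B h3
      _ ≤ _ := hsa.neg_algebraMap_norm_le_self
  -- Conjugating by the positive part `h` of `f² - 1/4` removes the region where the lower bound is
  -- negative. The resulting function is nonnegative and positive at `x₀`, where `f = 1`.
  let h : C(X, ℝ) := ⟨fun x => max (f x * f x - 1 / 4) 0, by fun_prop⟩
  have h6 := star_left_conjugate_le_conjugate h5 (ρ (scalarFun D h))
  have h7 : star (ρ (scalarFun D h)) * ρ (scalarFun D (f * f - ContinuousMap.const X (1 / 4))) *
      ρ (scalarFun D h) = ρ (scalarFun D (h * (f * f - ContinuousMap.const X (1 / 4)) * h)) := by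
    rw [← map_star, star_scalarFun, scalarFun_mul, scalarFun_mul, map_mul, map_mul]
  rw [h7] at h6
  obtain ⟨z, δ, hδ, hz⟩ := exists_conjugate_scalarFun_ge (x₀ := x₀)
    (q := h * (f * f - ContinuousMap.const X (1 / 4)) * h) hD hα ρ u hu hu1 hus (fun x => by
      change 0 ≤ max (f x * f x - 1 / 4) 0 * (f x * f x - 1 / 4) * max (f x * f x - 1 / 4) 0
      rcases le_total (f x * f x - 1 / 4) 0 with h | h
      · rw [max_eq_right h]; simp
      · rw [max_eq_left h]; positivity) (by
      change 0 < max (f x₀ * f x₀ - 1 / 4) 0 * (f x₀ * f x₀ - 1 / 4) * max (f x₀ * f x₀ - 1 / 4) 0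
      rw [show f x₀ = 1 from hf1 rfl]; norm_num)
  refine ⟨ρ F * ρ (scalarFun D h) * z, ?_⟩
  have h8 : algebraMap ℝ B δ ≤ star (ρ F * ρ (scalarFun D h) * z) * b *
      (ρ F * ρ (scalarFun D h) * z) := by
    calc algebraMap ℝ B δ ≤ _ := hz
      _ ≤ _ := star_left_conjugate_le_conjugate h6 z
      _ = _ := by simp only [star_mul, mul_assoc]
  exact CStarAlgebra.isUnit_of_le _ h8 (isStrictlyPositive_algebraMap hδ)

end Covariant

/-! ### The reduced crossed product -/

section CrossedProduct

variable {G : Type*} [Group G] {A : Type*} [CStarAlgebra A]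
variable {H : Type*} [NormedAddCommGroup H] [InnerProductSpace ℂ H] [CompleteSpace H]
variable (α : G →* (A ≃⋆ₐ[ℂ] A)) (π : A →⋆ₐ[ℂ] (H →L[ℂ] H))

theorem regularHom_mem (a : A) : regularHom α π a ∈ reducedCrossedProduct α π :=
  StarSubalgebra.le_topologicalClosure _ (StarAlgebra.subset_adjoin ℂ _ (Or.inl ⟨a, rfl⟩))

theorem translation_mem (g : G) : translation H g ∈ reducedCrossedProduct α π :=
  StarSubalgebra.le_topologicalClosure _ (StarAlgebra.subset_adjoin ℂ _ (Or.inr ⟨g, rfl⟩))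

/-- On the unit coordinate the regular representation acts as `π` itself. -/
theorem regularHom_injective (hπ : Function.Injective π) :
    Function.Injective (regularHom α π) := by
  classical
  intro a b h
  apply hπ
  ext v
  have h1 := congrArg (fun T : ell2 G H →L[ℂ] ell2 G H => T (lp.single 2 1 v) 1) h
  simpa [regularHom_apply, regularRep_apply] using h1

/-- Absolute squares of elements of the reduced crossed product are approximated by absolute
squares from the algebraic crossed product. -/
theorem exists_coeffSpan_approx {T : ell2 G H →L[ℂ] ell2 G H}
    (hT : T ∈ reducedCrossedProduct α π) {ε : ℝ} (hε : 0 < ε) :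
    ∃ T' ∈ reducedCrossedProduct α π, T' ∈ coeffSpan α π ∧
      ‖star T * T - star T' * T'‖ < ε := by
  have hcont : Continuous fun S : ell2 G H →L[ℂ] ell2 G H => star S * S :=
    continuous_star.mul continuous_id
  obtain ⟨_, ⟨T', hT', rfl⟩, hd⟩ := Metric.mem_closure_iff.1
    (image_closure_subset_closure_image hcont ⟨T, hT, rfl⟩) ε hε
  exact ⟨T', StarSubalgebra.le_topologicalClosure _ hT', mem_coeffSpan_of_mem_adjoin α π hT',
    by simpa only [dist_eq_norm] using hd⟩

end CrossedProduct

/-- The reduced crossed product of `C(X, D)` by an action over a minimal topologically free action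
on `X` is purely infinite and simple. -/
theorem isPurelyInfiniteSimple_reducedCrossedProduct
    {G : Type*} [Group G]
    {X : Type*} [TopologicalSpace X] [CompactSpace X] [T2Space X] [Nonempty X]
    [MulAction G X] [ContinuousConstSMul G X] [MulAction.IsMinimal G X]
    (hfree : IsTopologicallyFree G X)
    {D : Type*} [CStarAlgebra D] (hD : IsPurelyInfiniteSimple D)
    (α : G →* (C(X, D) ≃⋆ₐ[ℂ] C(X, D))) (hα : LiesOver α)
    {H : Type*} [NormedAddCommGroup H] [InnerProductSpace ℂ H] [CompleteSpace H]
    (π : C(X, D) →⋆ₐ[ℂ] (H →L[ℂ] H)) (hπ : Function.Injective π) :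
    IsPurelyInfiniteSimple (reducedCrossedProduct α π) := by
  let ρ : C(X, D) →⋆ₐ[ℂ] reducedCrossedProduct α π :=
    (regularHom α π).codRestrict _ (regularHom_mem α π)
  let u : G → reducedCrossedProduct α π := fun g => ⟨translation H g, translation_mem α π g⟩
  have hu : ∀ g a, u g * ρ a = ρ (α g a) * u g := fun g a =>
    Subtype.ext (translation_mul_regularHom α π g a)
  have hu1 : ∀ g, u g * u g⁻¹ = 1 := fun g => Subtype.ext <| by
    change translation H g * translation H g⁻¹ = 1
    rw [translation_mul, mul_inv_cancel, translation_one]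
  have hus : ∀ g, star (u g) = u g⁻¹ := fun g => Subtype.ext (star_translation g)
  have hρ : Function.Injective ρ := fun a b h =>
    regularHom_injective α π hπ (congrArg Subtype.val h)
  obtain ⟨w, hw1, hw2⟩ := hD.exists_isometry
  refine isPurelyInfiniteSimple_of_isUnit (w := ρ (ContinuousMap.const X w)) ?_ ?_ ?_
  · rw [← map_star, ← map_mul, ← map_one ρ]
    congr 1
    ext x
    exact hw1
  · rw [← map_star, ← map_mul, ← map_one ρ]
    intro h
    obtain ⟨x⟩ := ‹Nonempty X›
    exact hw2 (congrArg (fun f : C(X, D) => f x) (hρ h))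
  · intro c hc
    obtain ⟨g, hg⟩ := exists_corner_ne_zero (T := (c : ell2 G H →L[ℂ] ell2 G H))
      (fun h => hc (Subtype.ext h))
    have hκ := norm_pos_iff.2 hg
    set κ := ‖corner (star ((c : ell2 G H →L[ℂ] ell2 G H) * translation H g) *
      ((c : ell2 G H →L[ℂ] ell2 G H) * translation H g))‖ with hκdef
    -- The diagonal compression is contractive, so an approximation within `κ/2` keeps the norm of
    -- the coefficient at least `κ/2`. The coefficient is positive because its image under the
    -- injective `π` is the compression of `T*T`.
    obtain ⟨t, ht⟩ := exists_isUnit_conjugate (κ := κ / 2) hfree hD hα ρ u hu hu1 hus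
      (b := star (c * u g) * (c * u g)) (.star_mul_self _) (by positivity) (by
        intro ε hε
        obtain ⟨T, hT, hTs, hTε⟩ := exists_coeffSpan_approx α π (c * u g).2
          (lt_min hε (half_pos hκ))
        obtain ⟨a, S, hS, ha, hcut⟩ := exists_cutDown hα π
          (mul_mem_coeffSpan α π (star_mem_coeffSpan α π hTs) hTs)
        refine ⟨⟨star T * T, mul_mem (star_mem hT) hT⟩, a, S,
          (hTε.trans_le (min_le_left _ _)).le, isPos_of_map_isPos π hπ ?_, ?_, hS,
          fun f k hfk => Subtype.ext (hcut f k hfk)⟩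
        · rw [← ha]
          exact isPos_corner_star_mul_self T
        · have h1 : ‖π a‖ ≤ ‖a‖ := NonUnitalStarAlgHom.norm_apply_le π a
          have h2 := (norm_corner_le _).trans (hTε.trans_le (min_le_right _ _)).le
          rw [corner_sub, ha] at h2
          have h3 : κ - ‖π a‖ ≤ κ / 2 := (norm_sub_norm_le _ _).trans h2
          linarith)
    refine ⟨u g * t, ?_⟩
    convert ht using 1
    simp only [star_mul, mul_assoc]

end CrossedPI

theorem mainTheorem3
    {G : Type*} [Group G]
    {X : Type*} [TopologicalSpace X] [CompactSpace X] [T2Space X] [Nonempty X]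
    [MulAction G X] [ContinuousConstSMul G X] [MulAction.IsMinimal G X]
    (hfree : CrossedPI.IsTopologicallyFree G X)
    {D : Type*} [CStarAlgebra D] (hD : CrossedPI.IsPurelyInfiniteSimple D)
    (α : G →* (C(X, D) ≃⋆ₐ[ℂ] C(X, D))) (hα : CrossedPI.LiesOver α)
    {H : Type*} [NormedAddCommGroup H] [InnerProductSpace ℂ H] [CompleteSpace H]
    (π : C(X, D) →⋆ₐ[ℂ] (H →L[ℂ] H)) (hπ : Function.Injective π) :
    CrossedPI.IsPurelyInfiniteSimple (CrossedPI.reducedCrossedProduct α π) :=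
  CrossedPI.isPurelyInfiniteSimple_reducedCrossedProduct hfree hD α hα π hπ
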